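/- Let $1<Q<\infty$ and let $(X,d,\mu)$ be an unbounded, connected metric measure space whose Borel measure $\mu$ is Ahlfors $Q$-regular, i.e. there is $C_Q\ge 1$ with $r^Q/C_Q\le\mu(B(x,r))\le C_Q r^Q$ for all $x\in X$, $r>0$. Fix a base point $O\in X$. For $E\subset X$ and $\alpha>0$ let $\mathcal H^\alpha_\infty(E)=\inf\{\sum_{k\in\mathbb N} r_k^\alpha : E\subset\bigcup_{k} B(x_k,r_k)\}$, the infimum being over countable covers by balls, and for $C\ge1$ let $A_{C2^{j+1}}=B(O,C2^{j+2})\setminus B(O,C2^{j+1})$. An unbounded set $F\subset X$ is called *almost thick* if there are $\delta_j>0$ ($j\in\mathbb N$), $k\in\mathbb N$ and $C\ge1$ with $$\mathcal H^\alpha_\infty(F\cap A_{C2^{j+1}})\ge\delta_j\,(2^{j+1})^\alpha\quad\text{for all } j\ge k \text{ and all } 0<\alpha<Q,$$ and *thick* if this holds with $\delta_j=\delta>0$ independent of $j$. Let $\dot N^{1,Q}(X)$ be the set of locally integrable functions $u:X\to\mathbb R$ that have an upper gradient $\rho$ with $\int_X\rho^Q\,d\mu<\infty$, i.e. a Borel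 function $\rho:X\to[0,\infty]$ such that $|u(x)-u(y)|\le\int_\gamma\rho\,ds$ for every rectifiable curve $\gamma$ joining $x$ and $y$. An *infinite curve* is a continuous, locally rectifiable $\gamma:[0,\infty)\to X$ that is not contained in any ball. Then there are an almost thick set $F\subset X$ which is not thick and a function $f\in\dot N^{1,Q}(X)$ such that $$\lim_{F\ni x,\ d(O,x)\to\infty} f(x)\ \text{ exists (and is finite)},$$ but for no infinite curve $\gamma$ does $\lim_{t\to\infty}f(\gamma(t))$ exist in $[-\infty,\infty]$. In particular, it is not true on $X$ that whenever $u\in\dot N^{1,Q}(X)$ has a limit $c\in[-\infty,\infty]$ at infinity along some almost thick set, there is an infinite curve $\gamma$ with $\lim_{t\to\infty}u(\gamma(t))=c$. (Thus "thick" cannot be weakened to "almost thick" in a statement of this form.) -/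

import Mathlib

open Set Filter Topology MeasureTheory Metric
open scoped NNReal ENNReal

/-- `μ` is Ahlfors `Q`-regular: every ball of radius `r > 0` has measure comparable to `r ^ Q`.
(A measure on the Borel sets extends uniquely to a Borel regular outer measure.) -/
def IsAhlforsRegular {X : Type*} [MetricSpace X] [MeasurableSpace X]
    (μ : Measure X) (Q : ℝ) : Prop :=
  ∃ C : ℝ, 1 ≤ C ∧ ∀ (x : X) (r : ℝ), 0 < r →
    ENNReal.ofReal (r ^ Q / C) ≤ μ (ball x r) ∧ μ (ball x r) ≤ ENNReal.ofReal (C * r ^ Q)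

/-- A Borel function `ρ : X → [0,∞]` is an upper gradient of `u` if
`|u x - u y| ≤ ∫_γ ρ ds` for every rectifiable curve `γ` from `x` to `y`. Rectifiable curves are
parametrized by arc length on `[0, L]`, with `L` the length of the curve, so that
`∫_γ ρ ds = ∫_0^L ρ (γ t) dt`. -/
def IsUpperGradient {X : Type*} [MetricSpace X] [MeasurableSpace X]
    (u : X → ℝ) (ρ : X → ℝ≥0∞) : Prop :=
  Measurable ρ ∧ ∀ (L : ℝ) (γ : ℝ → X), 0 ≤ L → HasUnitSpeedOn γ (Icc 0 L) →
    ENNReal.ofReal |u (γ 0) - u (γ L)| ≤ ∫⁻ t in Icc 0 L, ρ (γ t)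

/-- The homogeneous Sobolev space `Ṅ^{1,p}(X)`: locally integrable functions having a
`p`-integrable upper gradient. -/
def HomogeneousSobolev {X : Type*} [MetricSpace X] [MeasurableSpace X]
    (μ : Measure X) (p : ℝ) : Set (X → ℝ) :=
  {u | LocallyIntegrable u μ ∧
    ∃ ρ : X → ℝ≥0∞, IsUpperGradient u ρ ∧ ∫⁻ x, ρ x ^ p ∂μ < ∞}

/-- The `(β, R)`-Hausdorff content: the infimum of `∑ r_k ^ β` over all covers of `E` by sequences
of balls `B(x_k, r_k)` with `0 < r_k < R`. -/
noncomputable def hausdorffContent {X : Type*} [MetricSpace X]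
    (β : ℝ) (R : ℝ≥0∞) (E : Set X) : ℝ≥0∞ :=
  ⨅ (x : ℕ → X) (r : ℕ → ℝ) (_ : ∀ k, 0 < r k ∧ ENNReal.ofReal (r k) < R)
    (_ : E ⊆ ⋃ k, ball (x k) (r k)), ∑' k, ENNReal.ofReal (r k ^ β)

/-- The annulus `A_R = B(O, 2R) \ B(O, R)`; it is used with `R = C 2^{j+1}`. -/
def annulusAt {X : Type*} [MetricSpace X] (O : X) (R : ℝ) : Set X :=
  ball O (2 * R) \ ball O R

/-- `F` is thick (dyadic `Q`-thick at infinity, with respect to the base point `O`). -/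
def IsThick {X : Type*} [MetricSpace X] (O : X) (Q : ℝ) (F : Set X) : Prop :=
  ¬ Bornology.IsBounded F ∧
  ∃ (δ : ℝ) (k : ℕ) (C : ℝ), 0 < δ ∧ 1 ≤ C ∧
    ∀ j : ℕ, k ≤ j → ∀ α : ℝ, 0 < α → α < Q →
      ENNReal.ofReal (δ * ((2 : ℝ) ^ (j + 1)) ^ α) ≤
        hausdorffContent α ∞ (F ∩ annulusAt O (C * 2 ^ (j + 1)))

/-- `F` is almost thick (with respect to the base point `O`): as `IsThick`, but the lower bound
`δ j > 0` may depend on the annulus. -/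
def IsAlmostThick {X : Type*} [MetricSpace X] (O : X) (Q : ℝ) (F : Set X) : Prop :=
  ¬ Bornology.IsBounded F ∧
  ∃ (δ : ℕ → ℝ) (k : ℕ) (C : ℝ), (∀ j, 0 < δ j) ∧ 1 ≤ C ∧
    ∀ j : ℕ, k ≤ j → ∀ α : ℝ, 0 < α → α < Q →
      ENNReal.ofReal (δ j * ((2 : ℝ) ^ (j + 1)) ^ α) ≤
        hausdorffContent α ∞ (F ∩ annulusAt O (C * 2 ^ (j + 1)))

/-- An infinite curve: a continuous, locally rectifiable `γ : [0,∞) → X` that is not contained in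
any ball. The parametrization need not be by arc length. -/
def IsInfiniteCurve {X : Type*} [MetricSpace X] (γ : ℝ≥0 → X) : Prop :=
  Continuous γ ∧ LocallyBoundedVariationOn γ univ ∧ ∀ (x : X) (r : ℝ), ∃ t, γ t ∉ ball x r

/-- `u x → c ∈ [-∞,∞]` as `x ∈ F` and `d(O, x) → ∞`. -/
def HasLimitAlongSet {X : Type*} [MetricSpace X] (O : X) (u : X → ℝ) (F : Set X)
    (c : EReal) : Prop :=
  Tendsto (fun x => (u x : EReal)) (comap (fun x => dist O x) atTop ⊓ 𝓟 F) (𝓝 c)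

/-- `u (γ t) → c ∈ [-∞,∞]` as `t → ∞`. -/
def HasLimitAlongCurve {X : Type*} [MetricSpace X] (u : X → ℝ) (γ : ℝ≥0 → X)
    (c : EReal) : Prop :=
  Tendsto (fun t => (u (γ t) : EReal)) atTop (𝓝 c)

/-!
The function is an oscillation of small `Q`-energy, in which tiny wells of small `Q`-energy are dug.

Because `Q > 1`, a cutoff function that goes from `0` on `B(p, r)` to `1` outside `B(p, 2 ^ N r)` in
`N` equal steps, one for each dyadic shell, has `Q`-energy at most a constant times `N ^ (1 - Q)`
(`lintegral_logCutoffGradient_rpow_le`), whatever `p` and `r` are. That such a function has the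
obvious upper gradient follows from `isUpperGradient_clamp_dist`: along a unit speed curve the
distance to `p` is `1`-Lipschitz. Integers `N_m` are chosen so that the energies decrease fast.

* Around the base point `O` the cutoffs across the successive ranges `[S_m, S_{m + 1}]`, where
  `S_{m + 1} = 2 ^ (N_m) S_m`, add up to a phase which equals `m` on the sphere `d(x, O) = S_m`.
  Hence `(1 - cos (π phase)) / 2` alternates between `0` and `1` on these spheres.
* Connectedness and unboundedness give points `p_j` with `d(p_j, O) = 3 * 2 ^ j`. Subtracting
  `1 - cutoff` around each `p_j`, with outer radius `2 ^ (-j) / 4`, and taking the positive part makes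
  the function vanish on the union `F` of tiny balls `B(p_j, r_j)`.

On `F` the limit is `0`. The wells do not meet the spheres of radius a power of two, and an infinite
curve crosses all large spheres arbitrarily late, so it sees both values `0` and `1` arbitrarily late
(`not_hasLimitAlongCurve_oscillationWithWells`). Ahlfors regularity bounds the content of each
`B(p_j, r_j)` below by a multiple of `r_j ^ α` (`rpow_div_le_hausdorffContent_ball`), so `F` is almost
thick; it is not thick because `∑ r_j < ∞` bounds the content of `F` of dimension `1 < Q`, while
thickness would make the content of its pieces unbounded
(`not_isThick_iUnion_ball_wellRadius`).
-/

/-! ### Upper gradients -/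

theorem HasUnitSpeedOn.lipschitzOnWith {X : Type*} [MetricSpace X] {γ : ℝ → X} {s : Set ℝ}
    (h : HasUnitSpeedOn γ s) : LipschitzOnWith 1 γ s := by
  have key : ∀ x ∈ s, ∀ y ∈ s, x ≤ y → edist (γ x) (γ y) ≤ edist x y := by
    intro x hx y hy hxy
    have h1 : edist (γ x) (γ y) ≤ eVariationOn γ (s ∩ Icc x y) :=
      eVariationOn.edist_le _ ⟨hx, left_mem_Icc.2 hxy⟩ ⟨hy, right_mem_Icc.2 hxy⟩
    rw [h hx hy, NNReal.coe_one, one_mul] at h1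
    rwa [edist_comm x y, edist_dist y x, Real.dist_eq, abs_of_nonneg (sub_nonneg.2 hxy)]
  intro x hx y hy
  rw [ENNReal.coe_one, one_mul]
  rcases le_total x y with hxy | hxy
  · exact key x hx y hy hxy
  · rw [edist_comm (γ x), edist_comm x]
    exact key y hy x hx hxy

section UpperGradient

variable {X : Type*} [MetricSpace X] [MeasurableSpace X]

/-- The half-open spherical shell `{x | a ≤ d(x, p) < b}`. -/
def shell (p : X) (a b : ℝ) : Set X := {x | a ≤ dist x p ∧ dist x p < b}

theorem measurableSet_shell [BorelSpace X] (p : X) (a b : ℝ) : MeasurableSet (shell p a b) :=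
  have h : Measurable fun x => dist x p := (continuous_id.dist continuous_const).measurable
  (measurableSet_le measurable_const h).inter (measurableSet_lt h measurable_const)

/-- Along a unit speed curve the distance to `p` is a `1`-Lipschitz function, so the time spent in
the shell is at least the length of the interval of distances that the curve sweeps there. -/
theorem isUpperGradient_clamp_dist [BorelSpace X] (p : X) (a b : ℝ) :
    IsUpperGradient (fun x => max a (min (dist x p) b)) ((shell p a b).indicator 1) := by
  refine ⟨measurable_one.indicator (measurableSet_shell p a b), fun L γ hL hγ => ?_⟩
  have hlip := hγ.lipschitzOnWith
  set s : ℝ → ℝ := fun t => dist (γ t) p with hs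
  have hslip : LipschitzOnWith 1 s (Icc 0 L) := by
    simpa [Function.comp_def] using (LipschitzWith.dist_left p).comp_lipschitzOnWith hlip
  set T : Set ℝ := γ ⁻¹' shell p a b ∩ Icc 0 L with hT
  have hint : ∫⁻ t in Icc 0 L, (shell p a b).indicator (1 : X → ℝ≥0∞) (γ t) = volume T := by
    have hnull : NullMeasurableSet (γ ⁻¹' shell p a b) (volume.restrict (Icc 0 L)) :=
      (hlip.continuousOn.aemeasurable measurableSet_Icc).nullMeasurableSet_preimage
        (measurableSet_shell p a b)
    have := lintegral_indicator_one₀ hnull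
    rw [Measure.restrict_apply' measurableSet_Icc] at this
    exact this
  rw [hint]
  -- The clamped values lie in `[a, b]`, so a value strictly below the larger one is below `b`; the
  -- intermediate value theorem then produces it as a distance attained inside the shell.
  have himage : Ico (min (max a (min (s 0) b)) (max a (min (s L) b)))
      (max (max a (min (s 0) b)) (max a (min (s L) b))) ⊆ s '' T := by
    intro v hv
    have hv' : v ∈ uIcc (s 0) (s L) ∧ a ≤ v ∧ v < b := by
      rw [mem_uIcc]
      simp only [mem_Ico, min_le_iff, max_le_iff, lt_max_iff, lt_min_iff] at hv
      grind
    have hc : ContinuousOn s (uIcc 0 L) := by rw [uIcc_of_le hL]; exact hslip.continuousOn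
    obtain ⟨t, ht, rfl⟩ := intermediate_value_uIcc hc hv'.1
    rw [uIcc_of_le hL] at ht
    exact ⟨t, ⟨hv'.2, ht⟩, rfl⟩
  calc ENNReal.ofReal |max a (min (s 0) b) - max a (min (s L) b)|
      = volume (Ico (min (max a (min (s 0) b)) (max a (min (s L) b)))
          (max (max a (min (s 0) b)) (max a (min (s L) b)))) := by
        rw [Real.volume_Ico, max_sub_min_eq_abs']
    _ ≤ volume (s '' T) := measure_mono himage
    _ ≤ volume T := by
        have := (hslip.mono (inter_subset_right : T ⊆ Icc 0 L)).hausdorffMeasure_image_le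
          (d := 1) zero_le_one
        simpa [hausdorffMeasure_real] using this

theorem IsUpperGradient.aemeasurable_comp [BorelSpace X] {u : X → ℝ} {ρ : X → ℝ≥0∞}
    (h : IsUpperGradient u ρ) {L : ℝ} {γ : ℝ → X} (hγ : HasUnitSpeedOn γ (Icc 0 L)) :
    AEMeasurable (fun t => ρ (γ t)) (volume.restrict (Icc 0 L)) :=
  h.1.comp_aemeasurable (hγ.lipschitzOnWith.continuousOn.aemeasurable measurableSet_Icc)

theorem IsUpperGradient.const_mul [BorelSpace X] {u : X → ℝ} {ρ : X → ℝ≥0∞}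
    (h : IsUpperGradient u ρ) {c : ℝ} (hc : 0 ≤ c) :
    IsUpperGradient (fun x => c * u x) (fun x => ENNReal.ofReal c * ρ x) := by
  refine ⟨h.1.const_mul _, fun L γ hL hγ => ?_⟩
  rw [lintegral_const_mul'' _ (h.aemeasurable_comp hγ), ← mul_sub, abs_mul, abs_of_nonneg hc,
    ENNReal.ofReal_mul hc]
  gcongr
  exact h.2 L γ hL hγ

theorem IsUpperGradient.tsum [BorelSpace X] {u : ℕ → X → ℝ} {ρ : ℕ → X → ℝ≥0∞}
    (h : ∀ m, IsUpperGradient (u m) (ρ m)) (hs : ∀ x, Summable fun m => u m x) :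
    IsUpperGradient (fun x => ∑' m, u m x) (fun x => ∑' m, ρ m x) := by
  refine ⟨Measurable.tsum fun m => (h m).1, fun L γ hL hγ => ?_⟩
  rw [lintegral_tsum fun m => (h m).aemeasurable_comp hγ, ← (hs _).tsum_sub (hs _)]
  refine le_trans ?_ (ENNReal.tsum_le_tsum fun m => (h m).2 L γ hL hγ)
  have := enorm_tsum_le_tsum_enorm (f := fun m => u m (γ 0) - u m (γ L))
  simpa only [Real.enorm_eq_ofReal_abs] using this

theorem IsUpperGradient.finset_sum [BorelSpace X] {ι : Type*} (s : Finset ι) {u : ι → X → ℝ}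
    {ρ : ι → X → ℝ≥0∞} (h : ∀ m, IsUpperGradient (u m) (ρ m)) :
    IsUpperGradient (fun x => ∑ m ∈ s, u m x) (fun x => ∑ m ∈ s, ρ m x) := by
  refine ⟨Finset.measurable_fun_sum _ fun m _ => (h m).1, fun L γ hL hγ => ?_⟩
  rw [lintegral_finsetSum' _ fun m _ => (h m).aemeasurable_comp hγ, ← Finset.sum_sub_distrib]
  refine le_trans ?_ (Finset.sum_le_sum fun m _ => (h m).2 L γ hL hγ)
  rw [← ENNReal.ofReal_sum_of_nonneg fun _ _ => abs_nonneg _]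
  exact ENNReal.ofReal_le_ofReal (Finset.abs_sum_le_sum_abs _ _)

theorem IsUpperGradient.of_abs_sub_le [BorelSpace X] {u v w : X → ℝ} {ρ σ : X → ℝ≥0∞}
    (hu : IsUpperGradient u ρ) (hv : IsUpperGradient v σ) {c : ℝ} (hc : 0 ≤ c)
    (h : ∀ x y, |w x - w y| ≤ c * (|u x - u y| + |v x - v y|)) :
    IsUpperGradient w (fun x => ENNReal.ofReal c * (ρ x + σ x)) := by
  refine ⟨(hu.1.add hv.1).const_mul _, fun L γ hL hγ => ?_⟩
  beta_reduce
  rw [lintegral_const_mul'' (f := fun t => ρ (γ t) + σ (γ t)) _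
      ((hu.aemeasurable_comp hγ).add (hv.aemeasurable_comp hγ)),
    lintegral_add_left' (hu.aemeasurable_comp hγ)]
  refine (ENNReal.ofReal_le_ofReal (h _ _)).trans ?_
  rw [ENNReal.ofReal_mul hc, ENNReal.ofReal_add (abs_nonneg _) (abs_nonneg _)]
  gcongr
  exacts [hu.2 L γ hL hγ, hv.2 L γ hL hγ]

theorem IsUpperGradient.one_sub {u : X → ℝ} {ρ : X → ℝ≥0∞} (h : IsUpperGradient u ρ) :
    IsUpperGradient (fun x => 1 - u x) ρ := by
  refine ⟨h.1, fun L γ hL hγ => ?_⟩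
  rw [sub_sub_sub_cancel_left, abs_sub_comm]
  exact h.2 L γ hL hγ

end UpperGradient

/-! ### Energy of sums -/

/-- Weighting the `m`-th term by `2 ^ m` trades the `q`-th power of a sum for a sum of `q`-th
powers. -/
theorem ENNReal.tsum_rpow_le (a : ℕ → ℝ≥0∞) {q : ℝ} (hq : 0 < q) :
    (∑' m, a m) ^ q ≤ 2 ^ q * ∑' m, ((2 : ℝ≥0∞) ^ m) ^ q * a m ^ q := by
  have h1 : ∀ m, (2 : ℝ≥0∞) ^ m * a m ≤ (∑' i, ((2 : ℝ≥0∞) ^ i) ^ q * a i ^ q) ^ q⁻¹ := by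
    intro m
    rw [ENNReal.le_rpow_inv_iff hq, ENNReal.mul_rpow_of_nonneg _ _ hq.le]
    exact ENNReal.le_tsum m
  have h2 : ∀ S, (∀ m, (2 : ℝ≥0∞) ^ m * a m ≤ S) → ∑' m, a m ≤ 2 * S := by
    intro S hS
    rw [← ENNReal.tsum_geometric_two, ← ENNReal.tsum_mul_right]
    refine ENNReal.tsum_le_tsum fun m => ?_
    calc a m = (2⁻¹ : ℝ≥0∞) ^ m * (2 ^ m * a m) := by
          rw [← mul_assoc, ← mul_pow, ENNReal.inv_mul_cancel two_ne_zero ENNReal.ofNat_ne_top,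
            one_pow, one_mul]
      _ ≤ _ := by gcongr; exact hS m
  calc (∑' m, a m) ^ q ≤ (2 * (∑' i, ((2 : ℝ≥0∞) ^ i) ^ q * a i ^ q) ^ q⁻¹) ^ q := by
        gcongr; exact h2 _ h1
    _ = _ := by
      rw [ENNReal.mul_rpow_of_nonneg _ _ hq.le, ← ENNReal.rpow_mul, inv_mul_cancel₀ hq.ne',
        ENNReal.rpow_one]

theorem lintegral_tsum_rpow_lt_top {X : Type*} [MeasurableSpace X] {μ : Measure X} {q : ℝ}
    (hq : 0 < q) {ρ : ℕ → X → ℝ≥0∞} (hρ : ∀ m, Measurable (ρ m))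
    (h : ∀ m, ∫⁻ x, ρ m x ^ q ∂μ ≤ 2⁻¹ ^ m * (((2 : ℝ≥0∞) ^ m) ^ q)⁻¹) :
    ∫⁻ x, (∑' m, ρ m x) ^ q ∂μ < ∞ := by
  have hmeas : ∀ m, Measurable fun x => ((2 : ℝ≥0∞) ^ m) ^ q * ρ m x ^ q := fun m =>
    ((hρ m).pow_const q).const_mul _
  have h2 : ∀ m : ℕ, ((2 : ℝ≥0∞) ^ m) ^ q ≠ 0 ∧ ((2 : ℝ≥0∞) ^ m) ^ q ≠ ∞ := fun m =>
    ⟨(ENNReal.rpow_pos (by positivity) (by finiteness)).ne',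
      ENNReal.rpow_ne_top_of_nonneg hq.le (by finiteness)⟩
  calc ∫⁻ x, (∑' m, ρ m x) ^ q ∂μ
      ≤ ∫⁻ x, 2 ^ q * ∑' m, ((2 : ℝ≥0∞) ^ m) ^ q * ρ m x ^ q ∂μ :=
        lintegral_mono fun x => ENNReal.tsum_rpow_le _ hq
    _ = 2 ^ q * ∑' m, ((2 : ℝ≥0∞) ^ m) ^ q * ∫⁻ x, ρ m x ^ q ∂μ := by
        rw [lintegral_const_mul _ (Measurable.tsum hmeas),
          lintegral_tsum fun m => (hmeas m).aemeasurable]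
        congr 2 with m
        rw [lintegral_const_mul _ ((hρ m).pow_const q)]
    _ ≤ 2 ^ q * ∑' m : ℕ, (2⁻¹ : ℝ≥0∞) ^ m := by
        gcongr with m
        calc ((2 : ℝ≥0∞) ^ m) ^ q * ∫⁻ x, ρ m x ^ q ∂μ
            ≤ ((2 : ℝ≥0∞) ^ m) ^ q * (2⁻¹ ^ m * (((2 : ℝ≥0∞) ^ m) ^ q)⁻¹) := by gcongr; exact h m
          _ = 2⁻¹ ^ m := by
            rw [mul_left_comm, ENNReal.mul_inv_cancel (h2 m).1 (h2 m).2, mul_one]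
    _ < ∞ := by
        rw [ENNReal.tsum_geometric_two]
        exact ENNReal.mul_lt_top (ENNReal.rpow_lt_top_of_nonneg hq.le (by finiteness))
          (by finiteness)

theorem sum_indicator_const_rpow_le {X ι : Type*} (s : Finset ι) {A : ι → Set X}
    (hA : Pairwise (Function.onFun Disjoint A)) (c : ι → ℝ≥0∞) {q : ℝ} (hq : 0 < q) (x : X) :
    (∑ i ∈ s, c i * (A i).indicator 1 x) ^ q ≤ ∑ i ∈ s, c i ^ q * (A i).indicator 1 x := by
  classical
  by_cases h : ∃ i ∈ s, x ∈ A i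
  · obtain ⟨i, hi, hx⟩ := h
    have h0 : ∀ j ∈ s, j ≠ i → (A j).indicator (1 : X → ℝ≥0∞) x = 0 := fun j _ hj =>
      indicator_of_notMem (fun hxj => disjoint_left.1 (hA hj) hxj hx) _
    rw [Finset.sum_eq_single_of_mem i hi fun j hj hji => by rw [h0 j hj hji, mul_zero],
      Finset.sum_eq_single_of_mem i hi fun j hj hji => by rw [h0 j hj hji, mul_zero]]
    simp [hx]
  · have h0 : ∀ j ∈ s, (A j).indicator (1 : X → ℝ≥0∞) x = 0 := fun j hj =>
      indicator_of_notMem (fun hxj => h ⟨j, hj, hxj⟩) _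
    rw [Finset.sum_eq_zero fun j hj => by rw [h0 j hj, mul_zero], ENNReal.zero_rpow_of_pos hq]
    exact zero_le

/-! ### Logarithmic cutoff functions -/

section LogCutoff

variable {X : Type*} [MetricSpace X]

/-- A piecewise linear substitute for the clamp of `log (d(x, p) / r) / log (2 ^ N)` to `[0, 1]`:
it increases by `1 / N` across each of the `N` dyadic shells `2 ^ i r ≤ d(x, p) < 2 ^ (i + 1) r`,
vanishes on `B(p, r)` and, if `N ≠ 0`, equals `1` outside `B(p, 2 ^ N r)`. -/
noncomputable def logCutoff (p : X) (r : ℝ) (N : ℕ) (x : X) : ℝ :=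
  ∑ i ∈ Finset.range N,
    (N * (2 ^ i * r))⁻¹ * (max (2 ^ i * r) (min (dist x p) (2 ^ (i + 1) * r)) - 2 ^ i * r)

theorem logCutoff_le_one (p : X) {r : ℝ} (hr : 0 < r) (N : ℕ) (x : X) :
    logCutoff p r N x ≤ 1 := by
  rcases N.eq_zero_or_pos with rfl | hN
  · simp [logCutoff]
  calc logCutoff p r N x ≤ ∑ i ∈ Finset.range N, (N : ℝ)⁻¹ := by
        refine Finset.sum_le_sum fun i _ => ?_
        have hi : 0 < 2 ^ i * r := by positivity
        rw [mul_inv, mul_assoc]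
        refine mul_le_of_le_one_right (by positivity) ?_
        rw [inv_mul_le_one₀ hi, sub_le_iff_le_add]
        refine max_le (by linarith) ((min_le_right _ _).trans ?_)
        rw [pow_succ]; linarith
    _ = 1 := by
        have : (N : ℝ) ≠ 0 := by positivity
        simp [this]

theorem logCutoff_eq_zero {p : X} {r : ℝ} (hr : 0 < r) (N : ℕ) {x : X} (h : dist x p ≤ r) :
    logCutoff p r N x = 0 := by
  refine Finset.sum_eq_zero fun i _ => ?_
  have hi : r ≤ 2 ^ i * r := le_mul_of_one_le_left hr.le (one_le_pow₀ one_le_two)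
  rw [max_eq_left ((min_le_left _ _).trans (h.trans hi)), sub_self, mul_zero]

theorem logCutoff_eq_one {p : X} {r : ℝ} (hr : 0 < r) {N : ℕ} (hN : N ≠ 0) {x : X}
    (h : 2 ^ N * r ≤ dist x p) : logCutoff p r N x = 1 := by
  have key : ∀ i ∈ Finset.range N, (N * (2 ^ i * r))⁻¹ *
      (max (2 ^ i * r) (min (dist x p) (2 ^ (i + 1) * r)) - 2 ^ i * r) = (N : ℝ)⁻¹ := by
    intro i hi
    have hi0 : 0 < 2 ^ i * r := by positivity
    have h1 : 2 ^ (i + 1) * r ≤ 2 ^ N * r := by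
      gcongr
      · exact one_le_two
      · exact Finset.mem_range.1 hi
    have h2 : 2 ^ (i + 1) * r = 2 ^ i * r + 2 ^ i * r := by rw [pow_succ]; ring
    rw [min_eq_right (h1.trans h), max_eq_right (by linarith), h2, add_sub_cancel_right, mul_inv,
      inv_mul_cancel_right₀ hi0.ne']
  rw [logCutoff, Finset.sum_congr rfl key]
  have : (N : ℝ) ≠ 0 := by positivity
  simp [this]

theorem continuous_logCutoff (p : X) (r : ℝ) (N : ℕ) : Continuous (logCutoff p r N) := by
  unfold logCutoff
  fun_prop

theorem pairwise_disjoint_dyadic_shell (p : X) {r : ℝ} (hr : 0 < r) :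
    Pairwise (Function.onFun Disjoint fun i : ℕ => shell p (2 ^ i * r) (2 ^ (i + 1) * r)) := by
  refine (pairwise_disjoint_on _).2 fun i j hij => disjoint_left.2 fun x hi hj => ?_
  have h : (2 : ℝ) ^ (i + 1) * r ≤ 2 ^ j * r := by
    gcongr
    · exact one_le_two
    · exact hij
  exact absurd (hi.2.trans_le (h.trans hj.1)) (lt_irrefl _)

variable [MeasurableSpace X] [BorelSpace X]

/-- The upper gradient of `logCutoff p r N` that equals `1 / (N 2 ^ i r)` on the `i`-th shell. -/
noncomputable def logCutoffGradient (p : X) (r : ℝ) (N : ℕ) (x : X) : ℝ≥0∞ :=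
  ∑ i ∈ Finset.range N,
    ENNReal.ofReal (N * (2 ^ i * r))⁻¹ * (shell p (2 ^ i * r) (2 ^ (i + 1) * r)).indicator 1 x

theorem isUpperGradient_logCutoff (p : X) {r : ℝ} (hr : 0 < r) (N : ℕ) :
    IsUpperGradient (logCutoff p r N) (logCutoffGradient p r N) := by
  refine IsUpperGradient.finset_sum _ fun i => IsUpperGradient.const_mul ?_ (by positivity)
  have h := isUpperGradient_clamp_dist p (2 ^ i * r) (2 ^ (i + 1) * r)
  refine ⟨h.1, fun L γ hL hγ => ?_⟩
  rw [sub_sub_sub_cancel_right]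
  exact h.2 L γ hL hγ

/-- Each of the `N` shells contributes at most `C (2 / N) ^ q`, whatever the scale `r`. -/
theorem lintegral_logCutoffGradient_rpow_le {μ : Measure X} {C q : ℝ} (hq : 0 < q)
    (hμ : ∀ (x : X) (r : ℝ), 0 < r → μ (ball x r) ≤ ENNReal.ofReal (C * r ^ q))
    (p : X) {r : ℝ} (hr : 0 < r) (N : ℕ) :
    ∫⁻ x, logCutoffGradient p r N x ^ q ∂μ ≤ ENNReal.ofReal (N * (C * (2 / N) ^ q)) := by
  have hmeas : ∀ i : ℕ, Measurable
      ((shell p (2 ^ i * r) (2 ^ (i + 1) * r)).indicator (1 : X → ℝ≥0∞)) := fun i =>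
    measurable_one.indicator (measurableSet_shell _ _ _)
  calc ∫⁻ x, logCutoffGradient p r N x ^ q ∂μ
      ≤ ∫⁻ x, ∑ i ∈ Finset.range N, ENNReal.ofReal (N * (2 ^ i * r))⁻¹ ^ q *
          (shell p (2 ^ i * r) (2 ^ (i + 1) * r)).indicator 1 x ∂μ :=
        lintegral_mono fun x =>
          sum_indicator_const_rpow_le _ (pairwise_disjoint_dyadic_shell p hr) _ hq x
    _ = ∑ i ∈ Finset.range N, ENNReal.ofReal (N * (2 ^ i * r))⁻¹ ^ q *
          μ (shell p (2 ^ i * r) (2 ^ (i + 1) * r)) := by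
        rw [lintegral_finsetSum _ fun i _ => (hmeas i).const_mul _]
        refine Finset.sum_congr rfl fun i _ => ?_
        rw [lintegral_const_mul _ (hmeas i), lintegral_indicator_one (measurableSet_shell _ _ _)]
    _ ≤ ∑ i ∈ Finset.range N, ENNReal.ofReal (C * (2 / N) ^ q) := by
        refine Finset.sum_le_sum fun i _ => ?_
        have hs : μ (shell p (2 ^ i * r) (2 ^ (i + 1) * r)) ≤
            ENNReal.ofReal (C * (2 ^ (i + 1) * r) ^ q) :=
          (measure_mono fun x hx => hx.2).trans (hμ p _ (by positivity))
        refine (mul_le_mul_right hs _).trans_eq ?_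
        have hi : (2 : ℝ) ^ i * r ≠ 0 := by positivity
        have h2 : ((N : ℝ) * (2 ^ i * r))⁻¹ * (2 ^ (i + 1) * r) = 2 / N := by
          rw [show (2 : ℝ) ^ (i + 1) * r = 2 ^ i * r * 2 by ring, mul_inv, mul_assoc,
            inv_mul_cancel_left₀ hi, inv_mul_eq_div]
        rw [ENNReal.ofReal_rpow_of_nonneg (by positivity) hq.le,
          ← ENNReal.ofReal_mul (by positivity), mul_left_comm,
          ← Real.mul_rpow (by positivity) (by positivity), h2]
    _ = ENNReal.ofReal (N * (C * (2 / N) ^ q)) := by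
        rw [Finset.sum_const, Finset.card_range, nsmul_eq_mul,
          ENNReal.ofReal_mul (Nat.cast_nonneg N), ENNReal.ofReal_natCast]

/-- Since `q > 1`, cutting off over many dyadic scales costs arbitrarily little energy, uniformly in
the centre and in the scale. -/
theorem exists_lintegral_logCutoffGradient_rpow_le {μ : Measure X} {C q : ℝ} (hq : 1 < q)
    (hμ : ∀ (x : X) (r : ℝ), 0 < r → μ (ball x r) ≤ ENNReal.ofReal (C * r ^ q))
    {ε : ℝ≥0∞} (hε : 0 < ε) :
    ∃ N : ℕ, N ≠ 0 ∧ ∀ (p : X) (r : ℝ), 0 < r →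
      ∫⁻ x, logCutoffGradient p r N x ^ q ∂μ ≤ ε := by
  have h1 : Tendsto (fun N : ℕ => C * 2 ^ q * (N : ℝ) ^ (-(q - 1))) atTop (𝓝 (C * 2 ^ q * 0)) :=
    ((tendsto_rpow_neg_atTop (by linarith)).comp tendsto_natCast_atTop_atTop).const_mul _
  rw [mul_zero] at h1
  have h2 := ENNReal.tendsto_ofReal h1
  rw [ENNReal.ofReal_zero] at h2
  obtain ⟨N, hN, hN0⟩ := ((h2.eventually (gt_mem_nhds hε)).and (eventually_ne_atTop 0)).exists
  refine ⟨N, hN0, fun p r hr => ?_⟩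
  refine (lintegral_logCutoffGradient_rpow_le (by linarith) hμ p hr N).trans (le_trans ?_ hN.le)
  refine ENNReal.ofReal_le_ofReal (le_of_eq ?_)
  have hN' : (0 : ℝ) < N := by positivity
  rw [Real.div_rpow zero_le_two hN'.le, neg_sub, Real.rpow_sub hN', Real.rpow_one]
  ring

end LogCutoff

/-! ### Hausdorff content -/

theorem hausdorffContent_mono {X : Type*} [MetricSpace X] (β : ℝ) (R : ℝ≥0∞) {E F : Set X}
    (h : E ⊆ F) : hausdorffContent β R E ≤ hausdorffContent β R F :=
  iInf₂_mono fun _ _ => iInf_mono fun _ => iInf_mono' fun hF => ⟨h.trans hF, le_rfl⟩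

theorem hausdorffContent_iUnion_ball_le {X : Type*} [MetricSpace X] (β : ℝ) (x : ℕ → X)
    {r : ℕ → ℝ} (hr : ∀ k, 0 < r k) :
    hausdorffContent β ∞ (⋃ k, ball (x k) (r k)) ≤ ∑' k, ENNReal.ofReal (r k ^ β) :=
  (iInf₂_le x r).trans <| (iInf_le _ fun k => ⟨hr k, ENNReal.ofReal_lt_top⟩).trans <|
    iInf_le _ subset_rfl

/-- If some covering ball is larger than `B(x, r)` the bound is immediate; otherwise
`r_k ^ Q ≤ r ^ (Q - α) r_k ^ α` and the bound follows from the subadditivity of `μ`. -/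
theorem rpow_div_le_hausdorffContent_ball {X : Type*} [MetricSpace X] [MeasurableSpace X]
    {μ : Measure X} {C Q : ℝ} (hC : 1 ≤ C)
    (hμ : ∀ (x : X) (r : ℝ), 0 < r →
      ENNReal.ofReal (r ^ Q / C) ≤ μ (ball x r) ∧ μ (ball x r) ≤ ENNReal.ofReal (C * r ^ Q))
    {α : ℝ} (hα : 0 < α) (hαQ : α < Q) (x : X) {r : ℝ} (hr : 0 < r) :
    ENNReal.ofReal (r ^ α / C ^ 2) ≤ hausdorffContent α ∞ (ball x r) := by
  refine le_iInf₂ fun y s => le_iInf₂ fun hs hcov => ?_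
  have hC0 : 0 < C := by linarith
  by_cases h : ∃ k, r < s k
  · obtain ⟨k, hk⟩ := h
    refine le_trans (ENNReal.ofReal_le_ofReal ?_) (ENNReal.le_tsum k)
    exact (div_le_self (by positivity) (one_le_pow₀ hC)).trans
      (Real.rpow_le_rpow hr.le hk.le hα.le)
  push Not at h
  have hpos : 0 < C * r ^ (Q - α) := by positivity
  have h1 : ENNReal.ofReal (C * r ^ (Q - α)) * ENNReal.ofReal (r ^ α / C ^ 2) ≤
      ENNReal.ofReal (C * r ^ (Q - α)) * ∑' k, ENNReal.ofReal (s k ^ α) := by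
    calc ENNReal.ofReal (C * r ^ (Q - α)) * ENNReal.ofReal (r ^ α / C ^ 2)
        = ENNReal.ofReal (r ^ Q / C) := by
          rw [← ENNReal.ofReal_mul hpos.le]
          congr 1
          rw [show r ^ Q = r ^ (Q - α) * r ^ α by rw [← Real.rpow_add hr, sub_add_cancel]]
          field_simp
      _ ≤ μ (ball x r) := (hμ x r hr).1
      _ ≤ μ (⋃ k, ball (y k) (s k)) := measure_mono hcov
      _ ≤ ∑' k, μ (ball (y k) (s k)) := measure_iUnion_le _
      _ ≤ ∑' k, ENNReal.ofReal (C * r ^ (Q - α)) * ENNReal.ofReal (s k ^ α) := by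
          refine ENNReal.tsum_le_tsum fun k => ((hμ _ _ (hs k).1).2).trans ?_
          rw [← ENNReal.ofReal_mul hpos.le, mul_assoc]
          refine ENNReal.ofReal_le_ofReal (mul_le_mul_of_nonneg_left ?_ hC0.le)
          rw [show s k ^ Q = s k ^ (Q - α) * s k ^ α by
            rw [← Real.rpow_add (hs k).1, sub_add_cancel]]
          have := (hs k).1
          have := sub_nonneg.2 hαQ.le
          gcongr
          exact h k
      _ = _ := ENNReal.tsum_mul_left
  exact (ENNReal.mul_le_mul_iff_right (ENNReal.ofReal_pos.2 hpos).ne' ENNReal.ofReal_ne_top).1 h1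

theorem exists_dist_eq_of_not_isBounded {X : Type*} [MetricSpace X] [ConnectedSpace X]
    (hX : ¬ Bornology.IsBounded (univ : Set X)) (O : X) {t : ℝ} (ht : 0 ≤ t) :
    ∃ x, dist x O = t := by
  have h : ∃ y, t ≤ dist y O := by
    by_contra! hcon
    exact hX (isBounded_ball.subset fun y _ => mem_ball.2 (hcon y))
  obtain ⟨y, hy⟩ := h
  exact mem_range_of_exists_le_of_exists_ge (continuous_id.dist continuous_const)
    ⟨O, by simpa using ht⟩ ⟨y, hy⟩

/-! ### The oscillating function and the wells -/

section Construction

variable {X : Type*} [MetricSpace X]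

/-- The scales `S_m = 2 ^ (N_0 + ⋯ + N_{m - 1})`, so that `S_{m + 1} = 2 ^ (N_m) S_m`. -/
noncomputable def scale (N : ℕ → ℕ) (m : ℕ) : ℝ := 2 ^ ∑ i ∈ Finset.range m, N i

/-- The phase `∑ m, logCutoff O S_m N_m`, which grows from `m` to `m + 1` between the spheres of
radii `S_m` and `S_{m + 1}` around `O`. -/
noncomputable def phase (O : X) (N : ℕ → ℕ) (x : X) : ℝ :=
  ∑' m, logCutoff O (scale N m) (N m) x

/-- The radius of the `j`-th well, chosen so that `2 ^ (N_j)` times it equals `2 ^ (-j) / 4`. -/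
noncomputable def wellRadius (N : ℕ → ℕ) (j : ℕ) : ℝ := (1 / 2) ^ j / 4 / 2 ^ N j

/-- A sum of bumps, the `j`-th being `1` on the ball of radius `wellRadius N j` around `p j` and `0`
at distance at least `2 ^ (-j) / 4` from `p j`, provided that `N_j ≠ 0`. -/
noncomputable def wellDepth (p : ℕ → X) (N : ℕ → ℕ) (x : X) : ℝ :=
  ∑' j, (1 - logCutoff (p j) (wellRadius N j) (N j) x)

/-- The oscillation `(1 - cos (π phase)) / 2`, pushed down to `0` in every well. -/
noncomputable def oscillationWithWells (O : X) (p : ℕ → X) (N : ℕ → ℕ) (x : X) : ℝ :=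
  max 0 ((1 - Real.cos (Real.pi * phase O N x)) / 2 - wellDepth p N x)

variable {O : X} {p : ℕ → X} {N : ℕ → ℕ}

theorem scale_pos (N : ℕ → ℕ) (m : ℕ) : 0 < scale N m := by unfold scale; positivity

theorem scale_succ (N : ℕ → ℕ) (m : ℕ) : scale N (m + 1) = 2 ^ N m * scale N m := by
  rw [scale, scale, Finset.sum_range_succ, pow_add, mul_comm]

theorem scale_mono (N : ℕ → ℕ) : Monotone (scale N) :=
  monotone_nat_of_le_succ fun m => by
    rw [scale_succ]
    exact le_mul_of_one_le_left (scale_pos N m).le (one_le_pow₀ one_le_two)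

theorem natCast_le_scale (hN : ∀ m, N m ≠ 0) (m : ℕ) : (m : ℝ) ≤ scale N m := by
  have h1 : m ≤ ∑ i ∈ Finset.range m, N i := by
    simpa using Finset.sum_le_sum (s := Finset.range m) (f := fun _ => 1) (g := N)
      fun i _ => Nat.one_le_iff_ne_zero.2 (hN i)
  have h2 : m ≤ 2 ^ ∑ i ∈ Finset.range m, N i := h1.trans Nat.lt_two_pow_self.le
  unfold scale
  exact_mod_cast h2

theorem summable_phase (hN : ∀ m, N m ≠ 0) (O x : X) :
    Summable fun m => logCutoff O (scale N m) (N m) x := by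
  obtain ⟨M, hM⟩ := exists_nat_ge (dist x O)
  refine summable_of_ne_finset_zero (s := Finset.range M) fun m hm => ?_
  rw [Finset.mem_range, not_lt] at hm
  refine logCutoff_eq_zero (scale_pos N m) _ (hM.trans ((natCast_le_scale hN m).trans' ?_))
  exact_mod_cast hm

theorem phase_eq_natCast (hN : ∀ m, N m ≠ 0) {x : X} {m : ℕ} (h : dist x O = scale N m) :
    phase O N x = m := by
  have h1 : ∀ i ∈ Finset.range m, logCutoff O (scale N i) (N i) x = 1 := by
    intro i hi
    refine logCutoff_eq_one (scale_pos N i) (hN i) ?_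
    rw [← scale_succ, h]
    exact scale_mono N (Finset.mem_range.1 hi)
  have h0 : ∀ i ∉ Finset.range m, logCutoff O (scale N i) (N i) x = 0 := by
    intro i hi
    rw [Finset.mem_range, not_lt] at hi
    exact logCutoff_eq_zero (scale_pos N i) _ (h.le.trans (scale_mono N hi))
  rw [phase, tsum_eq_sum h0, Finset.sum_congr rfl h1]
  simp

theorem wellRadius_pos (N : ℕ → ℕ) (j : ℕ) : 0 < wellRadius N j := by
  unfold wellRadius; positivity

theorem two_pow_mul_wellRadius (N : ℕ → ℕ) (j : ℕ) :
    2 ^ N j * wellRadius N j = (1 / 2) ^ j / 4 := by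
  unfold wellRadius; field_simp

theorem two_pow_mul_wellRadius_le (N : ℕ → ℕ) (j : ℕ) : 2 ^ N j * wellRadius N j ≤ 1 / 4 := by
  rw [two_pow_mul_wellRadius]
  have : (1 / 2 : ℝ) ^ j ≤ 1 := pow_le_one₀ (by norm_num) (by norm_num)
  linarith

theorem wellRadius_le (N : ℕ → ℕ) (j : ℕ) : wellRadius N j ≤ (1 / 2) ^ j / 4 := by
  rw [← two_pow_mul_wellRadius]
  exact le_mul_of_one_le_left (wellRadius_pos N j).le (one_le_pow₀ one_le_two)

theorem wellRadius_le_quarter (N : ℕ → ℕ) (j : ℕ) : wellRadius N j ≤ 1 / 4 :=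
  (two_pow_mul_wellRadius_le N j).trans'
    (le_mul_of_one_le_left (wellRadius_pos N j).le (one_le_pow₀ one_le_two))

theorem one_sub_logCutoff_eq_zero (hN : ∀ m, N m ≠ 0) {j : ℕ} {x : X}
    (h : 1 / 4 ≤ dist x (p j)) : 1 - logCutoff (p j) (wellRadius N j) (N j) x = 0 := by
  rw [logCutoff_eq_one (wellRadius_pos N j) (hN j) ((two_pow_mul_wellRadius_le N j).trans h),
    sub_self]

theorem summable_wellDepth (hN : ∀ m, N m ≠ 0) (hp : ∀ j, dist (p j) O = 3 * 2 ^ j) (x : X) :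
    Summable fun j => 1 - logCutoff (p j) (wellRadius N j) (N j) x := by
  obtain ⟨M, hM⟩ := exists_nat_ge (dist x O)
  refine summable_of_ne_finset_zero (s := Finset.range M) fun j hj => ?_
  rw [Finset.mem_range, not_lt] at hj
  refine one_sub_logCutoff_eq_zero hN ?_
  have h1 := dist_triangle_left (p j) O x
  rw [hp j] at h1
  have h2 : (j : ℝ) ≤ 2 ^ j := by exact_mod_cast Nat.lt_two_pow_self.le
  have h3 : (1 : ℝ) ≤ 2 ^ j := one_le_pow₀ one_le_two
  have h4 : (M : ℝ) ≤ j := by exact_mod_cast hj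
  linarith

theorem wellDepth_nonneg (p : ℕ → X) (N : ℕ → ℕ) (x : X) : 0 ≤ wellDepth p N x :=
  tsum_nonneg fun j => sub_nonneg.2 (logCutoff_le_one _ (wellRadius_pos N j) _ _)

theorem one_le_wellDepth (hN : ∀ m, N m ≠ 0) (hp : ∀ j, dist (p j) O = 3 * 2 ^ j) {x : X} {j : ℕ}
    (h : x ∈ ball (p j) (wellRadius N j)) : 1 ≤ wellDepth p N x := by
  have h1 := (summable_wellDepth hN hp x).le_tsum j fun i _ =>
    sub_nonneg.2 (logCutoff_le_one (p i) (wellRadius_pos N i) (N i) x)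
  rwa [logCutoff_eq_zero (wellRadius_pos N j) _ (mem_ball.1 h).le, sub_zero] at h1

/-- The wells lie at distance about `3 * 2 ^ j` from `O`, away from the spheres of radius `2 ^ n`. -/
theorem wellDepth_eq_zero (hN : ∀ m, N m ≠ 0) (hp : ∀ j, dist (p j) O = 3 * 2 ^ j) {x : X} {n : ℕ}
    (h : dist x O = 2 ^ n) : wellDepth p N x = 0 := by
  rw [wellDepth, ← tsum_zero]
  congr 1 with j
  refine one_sub_logCutoff_eq_zero hN ?_
  have h1 := dist_triangle_left (p j) O x
  have h2 := dist_triangle x (p j) O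
  rw [hp j, h] at h1 h2
  have h3 : (1 : ℝ) ≤ 2 ^ j := one_le_pow₀ one_le_two
  rcases le_or_gt n (j + 1) with hn | hn
  · have h4 : (2 : ℝ) ^ n ≤ 2 ^ (j + 1) := pow_le_pow_right₀ one_le_two hn
    rw [pow_succ] at h4
    linarith
  · have h4 : (2 : ℝ) ^ (j + 2) ≤ 2 ^ n := pow_le_pow_right₀ one_le_two hn
    rw [pow_add] at h4
    linarith

theorem oscillationWithWells_mem_Icc (O : X) (p : ℕ → X) (N : ℕ → ℕ) (x : X) :
    oscillationWithWells O p N x ∈ Icc 0 1 := by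
  refine ⟨le_max_left _ _, max_le zero_le_one ?_⟩
  linarith [wellDepth_nonneg p N x, Real.neg_one_le_cos (Real.pi * phase O N x)]

theorem oscillationWithWells_eq_zero (hN : ∀ m, N m ≠ 0) (hp : ∀ j, dist (p j) O = 3 * 2 ^ j)
    {x : X} (h : x ∈ ⋃ j, ball (p j) (wellRadius N j)) : oscillationWithWells O p N x = 0 := by
  obtain ⟨j, hj⟩ := mem_iUnion.1 h
  refine max_eq_left ?_
  linarith [one_le_wellDepth hN hp hj, Real.neg_one_le_cos (Real.pi * phase O N x)]

theorem oscillationWithWells_of_dist_eq_scale (hN : ∀ m, N m ≠ 0)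
    (hp : ∀ j, dist (p j) O = 3 * 2 ^ j) {x : X} {m : ℕ} (h : dist x O = scale N m) :
    oscillationWithWells O p N x = (1 - (-1) ^ m) / 2 := by
  rw [oscillationWithWells, phase_eq_natCast hN h, wellDepth_eq_zero hN hp h, sub_zero, mul_comm,
    Real.cos_nat_mul_pi]
  rcases neg_one_pow_eq_or ℝ m with h | h <;> rw [h] <;> norm_num

theorem abs_oscillationWithWells_sub_le (O : X) (p : ℕ → X) (N : ℕ → ℕ) (x y : X) :
    |oscillationWithWells O p N x - oscillationWithWells O p N y| ≤
      2 * (|phase O N x - phase O N y| + |wellDepth p N x - wellDepth p N y|) := by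
  have h1 := Real.abs_cos_sub_cos_le (Real.pi * phase O N x) (Real.pi * phase O N y)
  rw [← mul_sub, abs_mul, abs_of_pos Real.pi_pos] at h1
  have h2 : Real.pi * |phase O N x - phase O N y| ≤ 4 * |phase O N x - phase O N y| := by
    gcongr; exact Real.pi_le_four
  refine (abs_max_sub_max_le_max _ _ _ _).trans (max_le (by rw [sub_self, abs_zero]; positivity) ?_)
  have h3 := abs_nonneg (wellDepth p N x - wellDepth p N y)
  grind

theorem measurable_oscillationWithWells [MeasurableSpace X] [BorelSpace X]
    (O : X) (p : ℕ → X) (N : ℕ → ℕ) : Measurable (oscillationWithWells O p N) := by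
  have h1 : Measurable (phase O N) :=
    Measurable.tsum fun m => (continuous_logCutoff _ _ _).measurable
  have h2 : Measurable (wellDepth p N) :=
    Measurable.tsum fun m => measurable_const.sub (continuous_logCutoff _ _ _).measurable
  unfold oscillationWithWells
  fun_prop

/-- With `N_m` large, the `m`-th cutoffs have energy at most `2 ^ (-m) 2 ^ (-m Q)`, which is enough
to sum them. -/
theorem oscillationWithWells_mem_homogeneousSobolev [MeasurableSpace X] [BorelSpace X]
    {μ : Measure X} [IsLocallyFiniteMeasure μ] {Q : ℝ} (hQ : 1 < Q) (hN : ∀ m, N m ≠ 0)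
    (hp : ∀ j, dist (p j) O = 3 * 2 ^ j)
    (hE : ∀ (m : ℕ) (x : X) (r : ℝ), 0 < r →
      ∫⁻ y, logCutoffGradient x r (N m) y ^ Q ∂μ ≤ 2⁻¹ ^ m * (((2 : ℝ≥0∞) ^ m) ^ Q)⁻¹) :
    oscillationWithWells O p N ∈ HomogeneousSobolev μ Q := by
  refine ⟨(locallyIntegrable_const (1 : ℝ)).mono
    (measurable_oscillationWithWells O p N).aestronglyMeasurable (ae_of_all _ fun x => ?_), ?_⟩
  · have h := oscillationWithWells_mem_Icc O p N x
    rw [norm_one, Real.norm_eq_abs, abs_of_nonneg h.1]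
    exact h.2
  have h1 : ∀ m, IsUpperGradient (logCutoff O (scale N m) (N m))
      (logCutoffGradient O (scale N m) (N m)) := fun m =>
    isUpperGradient_logCutoff O (scale_pos N m) _
  have h2 : ∀ j, IsUpperGradient (logCutoff (p j) (wellRadius N j) (N j))
      (logCutoffGradient (p j) (wellRadius N j) (N j)) := fun j =>
    isUpperGradient_logCutoff _ (wellRadius_pos N j) _
  have h3 := (IsUpperGradient.tsum h1 (summable_phase hN O)).of_abs_sub_le
    (IsUpperGradient.tsum (fun j => (h2 j).one_sub) (summable_wellDepth hN hp)) zero_le_two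
    (abs_oscillationWithWells_sub_le O p N)
  refine ⟨_, h3, ?_⟩
  have hQ0 : 0 < Q := one_pos.trans hQ
  have e1 := lintegral_tsum_rpow_lt_top hQ0 (fun m => (h1 m).1)
    fun m => hE m O (scale N m) (scale_pos N m)
  have e2 := lintegral_tsum_rpow_lt_top hQ0 (fun m => (h2 m).1)
    fun m => hE m (p m) (wellRadius N m) (wellRadius_pos N m)
  have hmeas : Measurable fun x => ∑' m, logCutoffGradient O (scale N m) (N m) x :=
    Measurable.tsum fun m => (h1 m).1
  have e3 := ENNReal.lintegral_rpow_add_lt_top_of_lintegral_rpow_lt_top hmeas.aemeasurable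
    e1 e2 hQ.le
  simp_rw [ENNReal.mul_rpow_of_nonneg _ _ hQ0.le]
  rw [lintegral_const_mul' _ _ (ENNReal.rpow_ne_top_of_nonneg hQ0.le ENNReal.ofReal_ne_top)]
  exact ENNReal.mul_lt_top (ENNReal.rpow_lt_top_of_nonneg hQ0.le ENNReal.ofReal_ne_top) e3

/-! ### Thickness of the union of the wells -/

theorem isAlmostThick_iUnion_ball_wellRadius [MeasurableSpace X] {μ : Measure X} {Q : ℝ}
    (hμ : IsAhlforsRegular μ Q) (hp : ∀ j, dist (p j) O = 3 * 2 ^ j) :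
    IsAlmostThick O Q (⋃ j, ball (p j) (wellRadius N j)) := by
  obtain ⟨C, hC, hμ⟩ := hμ
  have hC0 : 0 < C := by linarith
  constructor
  · intro hb
    obtain ⟨R, hR⟩ := hb.subset_closedBall O
    obtain ⟨j, hj⟩ := exists_nat_gt R
    have h1 := mem_closedBall.1 (hR (mem_iUnion.2 ⟨j, mem_ball_self (wellRadius_pos N j)⟩))
    rw [hp j] at h1
    have h2 : (j : ℝ) ≤ 2 ^ j := by exact_mod_cast Nat.lt_two_pow_self.le
    have h3 : (0 : ℝ) < 2 ^ j := by positivity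
    linarith
  -- As `wellRadius N j ≤ 2 ^ (j + 1)`, the exponent `Q` makes this `δ j` work for all `α < Q`.
  refine ⟨fun j => (wellRadius N j / 2 ^ (j + 1)) ^ Q / C ^ 2, 0, 1, fun j => ?_, le_rfl,
    fun j _ α hα hαQ => ?_⟩
  · have := wellRadius_pos N j
    positivity
  have hr := wellRadius_pos N j
  have h1 : (1 : ℝ) ≤ 2 ^ j := one_le_pow₀ one_le_two
  have h2 : (2 : ℝ) ^ (j + 1) = 2 * 2 ^ j := by ring
  have hr4 := wellRadius_le_quarter N j
  have hsub : ball (p j) (wellRadius N j) ⊆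
      (⋃ j, ball (p j) (wellRadius N j)) ∩ annulusAt O (1 * 2 ^ (j + 1)) := by
    intro x hx
    refine ⟨mem_iUnion.2 ⟨j, hx⟩, ?_⟩
    rw [mem_ball] at hx
    have h3 := dist_triangle_left (p j) O x
    have h4 := dist_triangle x (p j) O
    rw [hp j] at h3 h4
    simp only [annulusAt, Set.mem_sdiff, mem_ball, not_lt]
    constructor <;> linarith
  refine le_trans ?_ ((rpow_div_le_hausdorffContent_ball hC hμ hα hαQ (p j) hr).trans
    (hausdorffContent_mono α ∞ hsub))
  refine ENNReal.ofReal_le_ofReal ?_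
  have h5 : (wellRadius N j / 2 ^ (j + 1)) ^ Q ≤ (wellRadius N j / 2 ^ (j + 1)) ^ α :=
    Real.rpow_le_rpow_of_exponent_ge (by positivity)
      (by rw [div_le_one (by positivity)]; linarith) hαQ.le
  rw [div_mul_eq_mul_div]
  gcongr
  calc _ ≤ (wellRadius N j / 2 ^ (j + 1)) ^ α * (2 ^ (j + 1)) ^ α := by gcongr
    _ = wellRadius N j ^ α := by
      rw [← Real.mul_rpow (by positivity) (by positivity), div_mul_cancel₀ _ (by positivity)]

/-- The radii of the wells are summable, so the whole union has finite `1`-dimensional content, while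
thickness would make the contents of its pieces grow like `2 ^ j`. -/
theorem not_isThick_iUnion_ball_wellRadius {Q : ℝ} (hQ : 1 < Q) :
    ¬ IsThick O Q (⋃ j, ball (p j) (wellRadius N j)) := by
  rintro ⟨-, δ, k, C, hδ, -, h⟩
  have h1 : ∀ j, k ≤ j → δ * 2 ^ (j + 1) ≤ 2 := by
    intro j hj
    have h2 := h j hj 1 one_pos hQ
    rw [Real.rpow_one] at h2
    have h3 : ∑' j, ENNReal.ofReal (wellRadius N j ^ (1 : ℝ)) ≤ ENNReal.ofReal 2 := by
      rw [← tsum_geometric_two, ENNReal.ofReal_tsum_of_nonneg (fun n => by positivity)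
        summable_geometric_two]
      refine ENNReal.tsum_le_tsum fun j => ENNReal.ofReal_le_ofReal ?_
      rw [Real.rpow_one]
      have : (0 : ℝ) ≤ (1 / 2) ^ j := by positivity
      linarith [wellRadius_le N j]
    exact (ENNReal.ofReal_le_ofReal_iff zero_le_two).1 <| h2.trans <|
      (hausdorffContent_mono 1 ∞ inter_subset_left).trans <|
        (hausdorffContent_iUnion_ball_le 1 p (wellRadius_pos N)).trans h3
  have h4 : Tendsto (fun j : ℕ => δ * 2 ^ (j + 1)) atTop atTop :=
    ((tendsto_pow_atTop_atTop_of_one_lt one_lt_two).comp (tendsto_add_atTop_nat 1)).const_mul_atTop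
      hδ
  obtain ⟨j, hj, hkj⟩ := ((h4.eventually_gt_atTop 2).and (eventually_ge_atTop k)).exists
  linarith [h1 j hkj]

/-! ### Infinite curves -/

theorem IsInfiniteCurve.exists_dist_eq {γ : ℝ≥0 → X} (hγ : IsInfiniteCurve γ) (O : X) (T : ℝ≥0) :
    ∃ R : ℝ, ∀ d, R ≤ d → ∃ t, T ≤ t ∧ dist (γ t) O = d := by
  obtain ⟨hc, -, hunb⟩ := hγ
  have hd : Continuous fun t => dist (γ t) O := hc.dist continuous_const
  obtain ⟨R, hR⟩ := (isCompact_Icc (a := (0 : ℝ≥0)) (b := T)).bddAbove_image hd.continuousOn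
  refine ⟨R + 1, fun d hRd => ?_⟩
  have hR' : ∀ t ≤ T, dist (γ t) O ≤ R := fun t ht => hR (mem_image_of_mem _ ⟨zero_le, ht⟩)
  obtain ⟨t, ht⟩ := hunb O (d + 1)
  rw [mem_ball, not_lt] at ht
  have hTt : T ≤ t := by
    by_contra! hlt
    linarith [hR' t hlt.le]
  obtain ⟨u, hu, hud⟩ := intermediate_value_Icc hTt hd.continuousOn
    (show d ∈ Icc (dist (γ T) O) (dist (γ t) O) from
      ⟨by linarith [hR' T le_rfl], by linarith⟩)
  exact ⟨u, hu.1, hud⟩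

/-- An infinite curve crosses all spheres `d(x, O) = S_m` with `m` large, arbitrarily late, and the
function is `0` there for even `m` and `1` for odd `m`. -/
theorem not_hasLimitAlongCurve_oscillationWithWells (hN : ∀ m, N m ≠ 0)
    (hp : ∀ j, dist (p j) O = 3 * 2 ^ j) {γ : ℝ≥0 → X} (hγ : IsInfiniteCurve γ) (c : EReal) :
    ¬ HasLimitAlongCurve (oscillationWithWells O p N) γ c := by
  intro hlim
  have key : ∀ b : ℕ, c = (((1 - (-1) ^ b) / 2 : ℝ) : EReal) := by
    intro b
    have hfreq : ∃ᶠ t in atTop, (oscillationWithWells O p N (γ t) : EReal) =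
        (((1 - (-1) ^ b) / 2 : ℝ) : EReal) := by
      refine frequently_atTop.2 fun T => ?_
      obtain ⟨R, hR⟩ := hγ.exists_dist_eq O T
      obtain ⟨m, hm⟩ := exists_nat_ge R
      -- The index `b + 2 * m` has the parity of `b` and is large enough for `S` to exceed `R`.
      obtain ⟨t, hTt, ht⟩ := hR (scale N (b + 2 * m)) <|
        (hm.trans (by exact_mod_cast (by omega : m ≤ b + 2 * m))).trans (natCast_le_scale hN _)
      refine ⟨t, hTt, ?_⟩
      rw [oscillationWithWells_of_dist_eq_scale hN hp ht, pow_add, pow_mul, neg_one_sq, one_pow,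
        mul_one]
    exact isClosed_singleton.mem_of_frequently_of_tendsto hfreq hlim
  have h := (key 0).symm.trans (key 1)
  norm_num at h

end Construction

/-! ### The counterexample -/

theorem IsAhlforsRegular.isLocallyFiniteMeasure {X : Type*} [MetricSpace X] [MeasurableSpace X]
    {μ : Measure X} {Q : ℝ} (hμ : IsAhlforsRegular μ Q) : IsLocallyFiniteMeasure μ := by
  obtain ⟨C, -, hμ⟩ := hμ
  exact ⟨fun x => ⟨ball x 1, ball_mem_nhds x one_pos,
    (hμ x 1 one_pos).2.trans_lt ENNReal.ofReal_lt_top⟩⟩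

theorem mainTheorem8 {X : Type*} [MetricSpace X] [ConnectedSpace X] [MeasurableSpace X]
    [BorelSpace X] (μ : Measure X) (Q : ℝ) (hQ : 1 < Q) (hμ : IsAhlforsRegular μ Q)
    (hX : ¬ Bornology.IsBounded (Set.univ : Set X)) (O : X) :
    (∃ (F : Set X) (f : X → ℝ),
      IsAlmostThick O Q F ∧ ¬ IsThick O Q F ∧ f ∈ HomogeneousSobolev μ Q ∧
      (∃ c : ℝ, HasLimitAlongSet O f F (c : EReal)) ∧
      ∀ γ : ℝ≥0 → X, IsInfiniteCurve γ → ¬ ∃ c : EReal, HasLimitAlongCurve f γ c) ∧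
    -- consequently a limit along an almost thick set does not force one along an infinite curve
    ¬ ∀ u ∈ HomogeneousSobolev μ Q, ∀ c : EReal,
      (∃ F : Set X, IsAlmostThick O Q F ∧ HasLimitAlongSet O u F c) →
        ∃ γ : ℝ≥0 → X, IsInfiniteCurve γ ∧ HasLimitAlongCurve u γ c := by
  have hQ0 : 0 < Q := by linarith
  have := hμ.isLocallyFiniteMeasure
  have hN : ∀ m : ℕ, ∃ N : ℕ, N ≠ 0 ∧ ∀ (x : X) (r : ℝ), 0 < r →
      ∫⁻ y, logCutoffGradient x r N y ^ Q ∂μ ≤ 2⁻¹ ^ m * (((2 : ℝ≥0∞) ^ m) ^ Q)⁻¹ := by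
    intro m
    obtain ⟨C, -, hμ⟩ := hμ
    refine exists_lintegral_logCutoffGradient_rpow_le hQ
      (fun x r hr => (hμ x r hr).2) (ENNReal.mul_pos ?_ ?_)
    · exact (ENNReal.pow_pos (by simp) m).ne'
    · exact ENNReal.inv_ne_zero.2 (ENNReal.rpow_ne_top_of_nonneg hQ0.le (by finiteness))
  choose N hN hE using hN
  choose p hp using fun j : ℕ =>
    exists_dist_eq_of_not_isBounded hX O (show (0 : ℝ) ≤ 3 * 2 ^ j by positivity)
  have hex : ∃ (F : Set X) (f : X → ℝ),
      IsAlmostThick O Q F ∧ ¬ IsThick O Q F ∧ f ∈ HomogeneousSobolev μ Q ∧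
      (∃ c : ℝ, HasLimitAlongSet O f F (c : EReal)) ∧
      ∀ γ : ℝ≥0 → X, IsInfiniteCurve γ → ¬ ∃ c : EReal, HasLimitAlongCurve f γ c := by
    refine ⟨⋃ j, ball (p j) (wellRadius N j), oscillationWithWells O p N,
      isAlmostThick_iUnion_ball_wellRadius hμ hp, not_isThick_iUnion_ball_wellRadius hQ,
      oscillationWithWells_mem_homogeneousSobolev hQ hN hp hE, ⟨0, ?_⟩, fun γ hγ ⟨c, hc⟩ =>
        not_hasLimitAlongCurve_oscillationWithWells hN hp hγ c hc⟩
    refine tendsto_const_nhds.congr' ?_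
    filter_upwards [mem_inf_of_right (mem_principal_self _)] with x hx
    rw [oscillationWithWells_eq_zero hN hp hx]
  refine ⟨hex, fun hall => ?_⟩
  obtain ⟨F, f, hF, -, hf, ⟨c, hc⟩, hno⟩ := hex
  obtain ⟨γ, hγ, hlim⟩ := hall f hf c ⟨F, hF, hc⟩
  exact hno γ hγ ⟨c, hlim⟩
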